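/- All digraphs are finite, have no loops and no parallel arcs, but may contain anti-parallel pairs of arcs. For a digraph $D$ let $|D|$ be its number of vertices, $\delta^+(D)$ its minimum out-degree, and $\chi(D)$ the chromatic number of its underlying simple graph (in which $u,v$ are adjacent iff $u\to v$ or $v\to u$). We say that $D$ is $H$-free, and write $H\not\subseteq D$, if $D$ has no (not necessarily induced) subdigraph isomorphic to $H$. The chromatic profile of $H$ is $$\delta^+_\chi(H,k)=\inf\{d\in\mathbb{R} : \text{there is } n_0 \text{ such that every digraph } D \text{ with } |D|\ge n_0,\ \delta^+(D)\ge d|D| \text{ and } H\not\subseteq D \text{ satisfies } \chi(D)\le k\}.$$ Let $C'_5, C''_5, C'''_5$ be the three orientations of the pentagon other than the directed 5-cycle, on the vertices $0,1,2,3,4$: $C'_5$ has arcs $0\to4\to3\to2\to1$ and $0\to1$; $C''_5$ has arcs $0\to4\to3\to2$ and $0\to1\to2$; $C'''_5$ has arcs $0\to4\to3\leftarrow2\to1\leftarrow0$. Theorem. $\delta^+_\chi(C'_5,2)=\delta^+_\chi(C''_5,2)=\delta^+_\chi(C'''_5,2)=\frac13$. Moreover, for every $\varepsilon>0$ there is $n_0=n_0(\varepsilon)$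 such that for each $H\in\{C'_5,C''_5,C'''_5\}$, every $H$-free digraph $D$ with $|D|\ge n_0$ and $\delta^+(D)>(\frac13+\varepsilon)|D|$ has a bipartite underlying graph. -/

import Mathlib

/-- `Digraph` in Mathlib allows loops; the digraphs considered here have none
(anti-parallel pairs of arcs are allowed). -/
def Digraph.Loopless {V : Type*} (D : Digraph V) : Prop :=
  ∀ v, ¬ D.Adj v v

/-- The out-degree of a vertex (meaningful for finite digraphs). -/
noncomputable def Digraph.outDeg {V : Type*} (D : Digraph V) (v : V) : ℕ :=
  {w : V | D.Adj v w}.ncard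

/-- The minimum out-degree of a finite digraph. -/
noncomputable def Digraph.minOutDeg {V : Type*} (D : Digraph V) : ℕ :=
  ⨅ v, D.outDeg v

/-- `H.ContainedIn D`: the digraph `D` has a (not necessarily induced) subdigraph
isomorphic to `H`. -/
def Digraph.ContainedIn {W V : Type*} (H : Digraph W) (D : Digraph V) : Prop :=
  ∃ f : W → V, Function.Injective f ∧ ∀ a b, H.Adj a b → D.Adj (f a) (f b)

/-- The underlying simple graph: `u` and `v` are joined iff `(u, v)` or `(v, u)` is an arc. -/
abbrev Digraph.underlying {V : Type*} (D : Digraph V) : SimpleGraph V :=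
  D.toSimpleGraphInclusive

/-- The set of all `d` such that, for every sufficiently large finite loopless digraph `D`,
if `δ⁺(D) ≥ d|D|` and `D` is `H`-free, then `χ(D) ≤ k`. -/
def Digraph.profileSet {W : Type*} (H : Digraph W) (k : ℕ) : Set ℝ :=
  {d : ℝ | ∃ n₀ : ℕ, ∀ (V : Type) [Finite V] (D : Digraph V), D.Loopless →
    n₀ ≤ Nat.card V →
    d * (Nat.card V : ℝ) ≤ (D.minOutDeg : ℝ) →
    ¬ H.ContainedIn D →
    D.underlying.chromaticNumber ≤ (k : ℕ∞)}

/-- The chromatic profile `δ⁺_χ(H, k)`. -/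
noncomputable def Digraph.chromaticProfile {W : Type*} (H : Digraph W) (k : ℕ) : ℝ :=
  sInf (H.profileSet k)

/-- The digraph on `{0, 1, 2, 3, 4}` whose arcs are the listed pairs. -/
def Digraph.ofArcs5 (l : List (Fin 5 × Fin 5)) : Digraph (Fin 5) where
  Adj a b := (a, b) ∈ l

/-- `C'_5`: the directed paths `0 → 4 → 3 → 2 → 1` and `0 → 1`. -/
def pentagon1 : Digraph (Fin 5) :=
  Digraph.ofArcs5 [(0, 4), (4, 3), (3, 2), (2, 1), (0, 1)]

/-- `C''_5`: the directed paths `0 → 4 → 3 → 2` and `0 → 1 → 2`. -/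
def pentagon2 : Digraph (Fin 5) :=
  Digraph.ofArcs5 [(0, 4), (4, 3), (3, 2), (1, 2), (0, 1)]

/-- `C'''_5`: `0 → 4 → 3 ← 2 → 1 ← 0`. -/
def pentagon3 : Digraph (Fin 5) :=
  Digraph.ofArcs5 [(0, 4), (4, 3), (2, 3), (2, 1), (0, 1)]

/-! If δ⁺ exceeds n/3 by a margin, then among any three vertices two share many out-neighbours. Call
such a pair related (`SharesOut`). Two vertices unrelated to a third are then related to each other.
Suppose a suitable arc joins unrelated vertices b, w. Every vertex is related to b or to w. In an
H-free digraph it cannot be related to both, and no arc joins two vertices on the same side, so the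
sides are a bipartition. For C''_5 the sides are defined by sharing at least one out-neighbour. A
forbidden pentagon is always closed by choosing common out-neighbours of related vertices away from
those already used.

The value 1/3 is sharp. Blow-ups of the directed triangle handle C''_5 and C'''_5; they do contain
C'_5, for which `sourceDigraph` is used instead. -/

namespace Digraph

variable {V : Type*}

/-- An abstraction of "`u` and `v` have many common out-neighbours" in a digraph in which every
three vertices contain a pair with that property. -/
structure SharesOut (D : Digraph V) (R : V → V → Prop) : Prop where
  loopless : D.Loopless
  refl : ∀ u, R u u
  symm : ∀ u v, R u v → R v u
  three : ∀ u v w, u ≠ v → u ≠ w → v ≠ w → R u v ∨ R u w ∨ R v w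
  pick : ∀ u v, R u v → ∀ l : List V, l.length ≤ 20 → ∃ x, x ∉ l ∧ D.Adj u x ∧ D.Adj v x

namespace SharesOut

variable {D : Digraph V} {R : V → V → Prop}

theorem ne_of_adj (h : SharesOut D R) {u v : V} (huv : D.Adj u v) : u ≠ v := by
  rintro rfl
  exact h.loopless _ huv

theorem pick_out (h : SharesOut D R) (u : V) (l : List V) (hl : l.length ≤ 20) :
    ∃ x, x ∉ l ∧ D.Adj u x := by
  obtain ⟨x, hx, hux, -⟩ := h.pick u u (h.refl u) l hl
  exact ⟨x, hx, hux⟩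

theorem rel_of_not_rel (h : SharesOut D R) {u v w : V} (huv : ¬ R u v) (huw : ¬ R u w) :
    R v w := by
  by_cases hvw : v = w
  · exact hvw ▸ h.refl v
  · have h1 : u ≠ v := fun e => huv (e ▸ h.refl u)
    have h2 : u ≠ w := fun e => huw (e ▸ h.refl u)
    have := h.three u v w h1 h2 hvw
    tauto

end SharesOut

theorem isBipartite_of_forall_adj {D : Digraph V} (c : V → Prop)
    (hc : ∀ u v, D.Adj u v → c u → c v → False)
    (hc' : ∀ u v, D.Adj u v → ¬ c u → ¬ c v → False) : D.underlying.IsBipartite := by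
  classical
  have C : D.underlying.Coloring Bool := by
    refine SimpleGraph.Coloring.mk (fun v => decide (c v)) ?_
    intro u v huv
    simp only [Digraph.underlying, Digraph.toSimpleGraphInclusive, SimpleGraph.fromRel_adj] at huv
    have h1 := hc u v
    have h2 := hc v u
    have h3 := hc' u v
    have h4 := hc' v u
    simp only [ne_eq, decide_eq_decide]
    tauto
  exact C.colorable

namespace SharesOut

variable {D : Digraph V} {R : V → V → Prop}

/-! ### The third pentagon -/

theorem not_rel_and_rel_of_adj (h : SharesOut D R) (hD : ¬ pentagon3.ContainedIn D) {u v w : V}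
    (huv : D.Adj u v) (hwu : w ≠ u) (hwv : w ≠ v) (h1 : R w u) (h2 : R w v) : False := by
  obtain ⟨x, hx, hwx, hux⟩ := h.pick w u h1 [u, v, w] (by simp)
  obtain ⟨y, hy, hwy, hvy⟩ := h.pick w v h2 [u, v, w, x] (by simp)
  have := h.ne_of_adj huv
  refine hD ⟨![u, x, w, y, v], ?_, ?_⟩
  · intro i j hij
    simp only [List.mem_cons, List.not_mem_nil, or_false, not_or] at hx hy
    fin_cases i <;> fin_cases j <;> simp at hij ⊢ <;> grind
  · intro i j hij
    fin_cases i <;> fin_cases j <;>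
      simp [pentagon3, Digraph.ofArcs5] at hij ⊢ <;> assumption

theorem exists_adj_not_rel (h : SharesOut D R) (hD : ¬ pentagon3.ContainedIn D) (u : V) :
    ∃ v, D.Adj u v ∧ ¬ R u v := by
  by_contra! hu
  obtain ⟨x, hx, hux⟩ := h.pick_out u [] (by simp)
  obtain ⟨y, hy, huy⟩ := h.pick_out u [x] (by simp)
  obtain ⟨z, hz, huz⟩ := h.pick_out u [x, y] (by simp)
  simp only [List.mem_cons, List.not_mem_nil, or_false, not_or] at hx hy hz
  have key : ∀ p q, D.Adj u p → D.Adj u q → p ≠ q → ¬ R p q := fun p q hp hq hpq hR =>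
    h.not_rel_and_rel_of_adj hD hq (h.ne_of_adj hp).symm hpq (h.symm _ _ (hu p hp)) hR
  have := h.three x y z
  have := key x y hux huy
  have := key x z hux huz
  have := key y z huy huz
  grind

theorem isBipartite_of_not_pentagon3 [Nonempty V] (h : SharesOut D R)
    (hD : ¬ pentagon3.ContainedIn D) : D.underlying.IsBipartite := by
  obtain ⟨u⟩ := ‹Nonempty V›
  obtain ⟨v, huv, hR⟩ := h.exists_adj_not_rel hD u
  have both : ∀ w, R w u → R w v → False := by
    intro w h1 h2
    refine h.not_rel_and_rel_of_adj hD huv ?_ ?_ h1 h2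
    · rintro rfl; exact hR h2
    · rintro rfl; exact hR (h.symm _ _ h1)
  have either : ∀ w, ¬ R w u → R w v := by
    intro w h1
    exact h.symm _ _ (h.rel_of_not_rel hR fun h2 => h1 (h.symm _ _ h2))
  have third : ∀ a p q w, D.Adj p q → w ≠ p → w ≠ q → ¬ R w a → ¬ R p a → ¬ R q a → False := by
    intro a p q w hpq hwp hwq h1 h2 h3
    refine h.not_rel_and_rel_of_adj hD hpq hwp hwq ?_ ?_
    · exact h.rel_of_not_rel (fun h4 => h1 (h.symm _ _ h4)) (fun h4 => h2 (h.symm _ _ h4))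
    · exact h.rel_of_not_rel (fun h4 => h1 (h.symm _ _ h4)) (fun h4 => h3 (h.symm _ _ h4))
  have key : ∀ a c, (∀ w, R w a → R w c → False) →
      ∀ p q, D.Adj p q → R p a → R q a → False := by
    intro a c hboth p q hpq hp hq
    -- An arc inside the class of `a` leaves no room for a third vertex there. Everything else then
    -- lies in the other class, where an arc and a further vertex give the same contradiction.
    have out : ∀ x, x ≠ p → x ≠ q → ¬ R x a := fun x hxp hxq hx =>
      third c p q x hpq hxp hxq (hboth x hx) (hboth p hp) (hboth q hq)
    obtain ⟨x, hx, -⟩ := h.pick_out p [p, q] (by simp)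
    obtain ⟨y, hy, hxy⟩ := h.pick_out x [p, q] (by simp)
    obtain ⟨z, hz, -⟩ := h.pick_out y [p, q, x, y] (by simp)
    simp only [List.mem_cons, List.not_mem_nil, or_false, not_or] at hx hy hz
    exact third a x y z hxy hz.2.2.1 hz.2.2.2 (out z hz.1 hz.2.1) (out x hx.1 hx.2)
      (out y hy.1 hy.2)
  exact isBipartite_of_forall_adj (fun w => R w u) (key u v both)
    fun p q hpq h1 h2 => key v u (fun w h3 h4 => both w h4 h3) p q hpq (either p h1)
      (either q h2)

/-! ### The second pentagon -/

theorem not_rel_of_adj_adj_adj (h : SharesOut D R) (hD : ¬ pentagon2.ContainedIn D)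
    {u v x y : V} (huv : D.Adj u v) (hux : D.Adj u x) (hvy : D.Adj v y) (hxy : x ≠ y)
    (hxv : x ≠ v) (hyu : y ≠ u) : ¬ R x y := by
  intro hR
  obtain ⟨t, ht, hxt, hyt⟩ := h.pick x y hR [u, v, x, y] (by simp)
  have := h.ne_of_adj huv
  have := h.ne_of_adj hux
  have := h.ne_of_adj hvy
  refine hD ⟨![u, x, t, y, v], ?_, ?_⟩
  · intro i j hij
    simp only [List.mem_cons, List.not_mem_nil, or_false, not_or] at ht
    fin_cases i <;> fin_cases j <;> simp at hij ⊢ <;> grind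
  · intro i j hij
    fin_cases i <;> fin_cases j <;>
      simp [pentagon2, Digraph.ofArcs5] at hij ⊢ <;> assumption

/-- A transitive triangle would make `c` an out-neighbour of both ends of `u → v`; with fresh
out-neighbours `x` of `u` and `y` of `v` it gives three pairwise unrelated vertices. -/
theorem disjoint_out_of_adj (h : SharesOut D R) (hD : ¬ pentagon2.ContainedIn D)
    {u v c : V} (huv : D.Adj u v) (huc : D.Adj u c) (hvc : D.Adj v c) : False := by
  obtain ⟨y, hy, hvy⟩ := h.pick_out v [u, c] (by simp)
  obtain ⟨x, hx, hux⟩ := h.pick_out u [v, c, y] (by simp)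
  simp only [List.mem_cons, List.not_mem_nil, or_false, not_or] at hx hy
  have h1 := h.not_rel_of_adj_adj_adj hD huv huc hvy
  have h2 := h.not_rel_of_adj_adj_adj hD huv hux hvy
  have h3 := h.not_rel_of_adj_adj_adj hD huv hux hvc
  have h4 := h.three x y c
  have h5 := h.symm y c
  have := h.ne_of_adj huc
  have := h.ne_of_adj hvc
  grind

theorem not_rel_of_adj (h : SharesOut D R) (hD : ¬ pentagon2.ContainedIn D)
    {u v : V} (huv : D.Adj u v) : ¬ R u v := by
  intro hR
  obtain ⟨x, -, h1, h2⟩ := h.pick u v hR [] (by simp)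
  exact h.disjoint_out_of_adj hD huv h1 h2

theorem rel_of_adj_adj (h : SharesOut D R) (hD : ¬ pentagon2.ContainedIn D)
    {u x y : V} (hux : D.Adj u x) (huy : D.Adj u y) : R x y := by
  obtain ⟨v, hv, huv⟩ := h.pick_out u [x, y] (by simp)
  obtain ⟨z, hz, hvz⟩ := h.pick_out v [u, x, y] (by simp)
  simp only [List.mem_cons, List.not_mem_nil, or_false, not_or] at hv hz
  have h1 := h.not_rel_of_adj_adj_adj hD huv hux hvz
  have h2 := h.not_rel_of_adj_adj_adj hD huv huy hvz
  have h3 := h.symm z x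
  have h4 := h.symm z y
  exact h.rel_of_not_rel (u := z) (by grind) (by grind)

theorem not_rel_of_adj_of_adj (h : SharesOut D R) (hD : ¬ pentagon2.ContainedIn D)
    {p q x y : V} (hpq : D.Adj p q) (hpx : D.Adj p x) (hqy : D.Adj q y) : ¬ R x y := by
  have hxy : x ≠ y := by
    rintro rfl
    exact h.disjoint_out_of_adj hD hpq hpx hqy
  by_cases h1 : x = q
  · subst h1
    exact h.not_rel_of_adj hD hqy
  by_cases h2 : y = p
  · subst h2
    exact fun h3 => h.not_rel_of_adj hD hpx (h.symm _ _ h3)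
  exact h.not_rel_of_adj_adj_adj hD hpq hpx hqy hxy h1 h2

theorem isBipartite_of_not_pentagon2 [Nonempty V] (h : SharesOut D R)
    (hD : ¬ pentagon2.ContainedIn D) : D.underlying.IsBipartite := by
  obtain ⟨b⟩ := ‹Nonempty V›
  obtain ⟨w, -, hbw⟩ := h.pick_out b [] (by simp)
  have hR := h.not_rel_of_adj hD hbw
  have key : ∀ c p q, D.Adj p q → (∃ x, D.Adj p x ∧ D.Adj c x) →
      (∃ x, D.Adj q x ∧ D.Adj c x) → False := by
    rintro c p q hpq ⟨x, hpx, hcx⟩ ⟨y, hqy, hcy⟩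
    exact h.not_rel_of_adj_of_adj hD hpq hpx hqy (h.rel_of_adj_adj hD hcx hcy)
  have either : ∀ v, ¬ (∃ x, D.Adj v x ∧ D.Adj b x) → ∃ x, D.Adj v x ∧ D.Adj w x := by
    intro v hv
    have h1 : ¬ R b v := fun hbv => by
      obtain ⟨x, -, h1, h2⟩ := h.pick b v hbv [] (by simp)
      exact hv ⟨x, h2, h1⟩
    obtain ⟨x, -, h2, h3⟩ := h.pick v w (h.rel_of_not_rel h1 hR) [] (by simp)
    exact ⟨x, h2, h3⟩
  exact isBipartite_of_forall_adj (fun v => ∃ x, D.Adj v x ∧ D.Adj b x) (key b)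
    fun p q hpq hp hq => key w p q hpq (either p hp) (either q hq)

/-! ### The first pentagon -/

/-- A directed path on three vertices. -/
structure Path3 (D : Digraph V) (u a b : V) : Prop where
  adj₁ : D.Adj u a
  adj₂ : D.Adj a b
  ne : u ≠ b

theorem Path3.next {u a b w : V} (hp : Path3 D u a b) (hbw : D.Adj b w) (hw : w ≠ a) :
    Path3 D a b w :=
  ⟨hp.adj₂, hbw, hw.symm⟩

/-- A common out-neighbour of the two ends closes the path to C'_5. -/
theorem not_rel_of_path4 (h : SharesOut D R) (hD : ¬ pentagon1.ContainedIn D)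
    {u a b w : V} (hua : D.Adj u a) (hab : D.Adj a b) (hbw : D.Adj b w) (hub : u ≠ b)
    (huw : u ≠ w) (haw : a ≠ w) : ¬ R u w := by
  intro hR
  obtain ⟨t, ht, hut, hwt⟩ := h.pick u w hR [u, a, b, w] (by simp)
  have := h.ne_of_adj hua
  have := h.ne_of_adj hab
  have := h.ne_of_adj hbw
  refine hD ⟨![u, t, w, b, a], ?_, ?_⟩
  · intro i j hij
    simp only [List.mem_cons, List.not_mem_nil, or_false, not_or] at ht
    fin_cases i <;> fin_cases j <;> simp at hij ⊢ <;> grind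
  · intro i j hij
    fin_cases i <;> fin_cases j <;>
      simp [pentagon1, Digraph.ofArcs5] at hij ⊢ <;> assumption

theorem rel_of_path3 (h : SharesOut D R) (hD : ¬ pentagon1.ContainedIn D) {u a b x y : V}
    (hp : Path3 D u a b) (hbx : D.Adj b x) (hby : D.Adj b y) (hxu : x ≠ u) (hxa : x ≠ a)
    (hyu : y ≠ u) (hya : y ≠ a) : R x y :=
  h.rel_of_not_rel (h.not_rel_of_path4 hD hp.adj₁ hp.adj₂ hbx hp.ne hxu.symm hxa.symm)
    (h.not_rel_of_path4 hD hp.adj₁ hp.adj₂ hby hp.ne hyu.symm hya.symm)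

theorem not_rel_of_path3_adj (h : SharesOut D R) (hD : ¬ pentagon1.ContainedIn D)
    {u a b w : V} (hp : Path3 D u a b) (hbw : D.Adj b w) : ¬ R b w := by
  intro hR
  obtain ⟨z, hz, hbz, hwz⟩ := h.pick b w hR [u, a, b, w] (by simp)
  obtain ⟨t, ht, hzt⟩ := h.pick_out z [u, a, b, w, z] (by simp)
  simp only [List.mem_cons, List.not_mem_nil, or_false, not_or] at hz ht
  have hbw' := h.ne_of_adj hbw
  have hbt : ¬ R b t := h.not_rel_of_path4 hD hbw hwz hzt (by tauto) (by tauto) (by tauto)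
  -- As `t` is related to its new out-neighbours, a path `s → q → r → p` can be grown inside the
  -- out-neighbourhood of `t`. Its ends are unrelated as ends of a path, yet related as
  -- out-neighbours of `t`.
  have step : ∀ s, D.Adj t s → s ∉ [u, a, b, w, z] → R s t := by
    intro s hts hs
    simp only [List.mem_cons, List.not_mem_nil, or_false, not_or] at hs
    refine h.rel_of_not_rel (fun hbs => ?_) hbt
    obtain ⟨q, hq, hbq, hsq⟩ := h.pick b s hbs [u, a, z, t] (by simp)
    simp only [List.mem_cons, List.not_mem_nil, or_false, not_or] at hq
    exact h.not_rel_of_path4 hD hzt hts hsq (by tauto) (by tauto) (by tauto)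
      (h.rel_of_path3 hD hp hbz hbq (by tauto) (by tauto) (by tauto) (by tauto))
  obtain ⟨s, hs, hts⟩ := h.pick_out t [u, a, b, w, z] (by simp)
  obtain ⟨q, hq, hsq, htq⟩ := h.pick s t (step s hts hs) [s, u, a, b, w, z] (by simp)
  obtain ⟨r, hr, hqr, htr⟩ := h.pick q t (step q htq (by grind)) [q, s, u, a, b, w, z] (by simp)
  obtain ⟨p, hp', hrp, htp⟩ :=
    h.pick r t (step r htr (by grind)) [r, q, s, u, a, b, w, z] (by simp)
  simp only [List.mem_cons, List.not_mem_nil, or_false, not_or] at hs hq hr hp'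
  exact h.not_rel_of_path4 hD hsq hqr hrp (by tauto) (by tauto) (by tauto)
    (h.rel_of_path3 hD (⟨hwz, hzt, by tauto⟩ : Path3 D w z t) hts htp (by tauto) (by tauto)
      (by tauto) (by tauto))

theorem rel_of_path3_adj_adj (h : SharesOut D R) (hD : ¬ pentagon1.ContainedIn D)
    {u a b w y : V} (hp : Path3 D u a b) (hbw : D.Adj b w) (hwy : D.Adj w y) (hwa : w ≠ a) :
    R b y := by
  have h1 := h.not_rel_of_path3_adj hD hp hbw
  have h2 := h.not_rel_of_path3_adj hD (hp.next hbw hwa) hwy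
  exact h.rel_of_not_rel (fun h3 => h1 (h.symm _ _ h3)) h2

theorem not_rel_and_rel_of_path3 (h : SharesOut D R) (hD : ¬ pentagon1.ContainedIn D)
    {u a b w : V} (hp : Path3 D u a b) (hbw : D.Adj b w) (hwu : w ≠ u) (hwa : w ≠ a) (v : V)
    (h1 : R v b) (h2 : R v w) : False := by
  have hbw' := h.ne_of_adj hbw
  obtain ⟨x, hx, hvx, hbx⟩ := h.pick v b h1 [u, a, b, w, v] (by simp)
  obtain ⟨y, hy, hvy, hwy⟩ := h.pick v w h2 [u, a, b, w, v, x] (by simp)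
  simp only [List.mem_cons, List.not_mem_nil, or_false, not_or] at hx hy
  obtain ⟨y₁, hy₁, hxy₁, hwy₁⟩ := h.pick x w
    (h.rel_of_path3 hD hp hbx hbw (by tauto) (by tauto) hwu hwa) [u, a, b, w, v, x] (by simp)
  simp only [List.mem_cons, List.not_mem_nil, or_false, not_or] at hy₁
  obtain ⟨x₂, hx₂, hbx₂, hy₁x₂⟩ := h.pick b y₁
    (h.rel_of_path3_adj_adj hD hp hbw hwy₁ hwa)
    [u, a, b, w, v, x, y₁] (by simp)
  obtain ⟨x₁, hx₁, hbx₁, hyx₁⟩ := h.pick b y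
    (h.rel_of_path3_adj_adj hD hp hbw hwy hwa)
    [u, a, b, w, v, y] (by simp)
  simp only [List.mem_cons, List.not_mem_nil, or_false, not_or] at hx₁ hx₂
  obtain ⟨y₂, hy₂, hx₁y₂, hwy₂⟩ := h.pick x₁ w
    (h.rel_of_path3 hD hp hbx₁ hbw (by tauto) (by tauto) hwu hwa)
    [u, a, b, w, v, y, x₁, x₂] (by simp)
  simp only [List.mem_cons, List.not_mem_nil, or_false, not_or] at hy₂
  -- The paths `v → x → y₁ → x₂` and `v → y → x₁ → y₂` alternate between out-neighbours of `b` and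
  -- of `w`. Their ends are related to each other, so they share some `t`; then `b → x₂ → t` relates
  -- `b` to `t`, while `b → w → y₂ → t` forbids it.
  have n1 : ¬ R v x₂ :=
    h.not_rel_of_path4 hD hvx hxy₁ hy₁x₂ (by tauto) (by tauto) (by tauto)
  have n2 : ¬ R v y₂ :=
    h.not_rel_of_path4 hD hvy hyx₁ hx₁y₂ (by tauto) (by tauto) (by tauto)
  obtain ⟨t, ht, hx₂t, hy₂t⟩ := h.pick x₂ y₂ (h.rel_of_not_rel n1 n2)
    [u, a, b, w, x₂, y₂] (by simp)
  simp only [List.mem_cons, List.not_mem_nil, or_false, not_or] at ht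
  exact h.not_rel_of_path4 hD hbw hwy₂ hy₂t (by tauto) (by tauto) (by tauto)
    (h.rel_of_path3_adj_adj hD hp hbx₂ hx₂t (by tauto))

theorem not_rel_rel_of_adj_of_path3 (h : SharesOut D R) (hD : ¬ pentagon1.ContainedIn D)
    {u a b c : V} (hp : Path3 D u a b) (hc : ∀ v, R v b → R v c → False) {p q : V}
    (hpq : D.Adj p q) (h1 : R p b) (h2 : R q b) : False := by
  obtain ⟨y, hy, hqy, hby⟩ := h.pick q b h2 [u, a, b, p, q] (by simp)
  obtain ⟨x, hx, hpx, hbx⟩ := h.pick p b h1 [u, a, b, p, q, y] (by simp)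
  simp only [List.mem_cons, List.not_mem_nil, or_false, not_or] at hx hy
  obtain ⟨t, ht, hxt, hyt⟩ := h.pick x y
    (h.rel_of_path3 hD hp hbx hby (by tauto) (by tauto) (by tauto) (by tauto))
    [u, a, b, p, q, x, y] (by simp)
  simp only [List.mem_cons, List.not_mem_nil, or_false, not_or] at ht
  have hbt : R b t :=
    h.rel_of_path3_adj_adj hD hp hbx hxt (by tauto)
  exact h.not_rel_of_path4 hD hpq hqy hyt (by tauto) (by tauto) (by tauto)
    (h.rel_of_not_rel (u := c) (fun h3 => hc p h1 (h.symm _ _ h3))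
      (fun h3 => hc t (h.symm _ _ hbt) (h.symm _ _ h3)))

theorem isBipartite_of_not_pentagon1 [Nonempty V] (h : SharesOut D R)
    (hD : ¬ pentagon1.ContainedIn D) : D.underlying.IsBipartite := by
  obtain ⟨u⟩ := ‹Nonempty V›
  obtain ⟨a, -, hua⟩ := h.pick_out u [] (by simp)
  obtain ⟨b, hb, hab⟩ := h.pick_out a [u] (by simp)
  obtain ⟨w, hw, hbw⟩ := h.pick_out b [u, a] (by simp)
  simp only [List.mem_cons, List.not_mem_nil, or_false, not_or] at hb hw
  have hp : Path3 D u a b := ⟨hua, hab, fun e => hb e.symm⟩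
  have both := h.not_rel_and_rel_of_path3 hD hp hbw hw.1 hw.2
  have either : ∀ v, ¬ R v b → R v w := fun v hv =>
    h.rel_of_not_rel (fun h3 => hv (h.symm _ _ h3))
      (h.not_rel_of_path3_adj hD hp hbw)
  exact isBipartite_of_forall_adj (fun v => R v b)
    (fun p q hpq h1 h2 => h.not_rel_rel_of_adj_of_path3 hD hp both hpq h1 h2)
    (fun p q hpq h1 h2 => h.not_rel_rel_of_adj_of_path3 hD (hp.next hbw hw.2)
      (fun v h3 h4 => both v h4 h3) hpq (either p h1) (either q h2))

end SharesOut

end Digraph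

/-! ### From the degree condition to the chromatic profile -/

namespace Digraph

variable {V : Type*}

/-- `u` and `v` have at least `k` common out-neighbours. -/
def ManyCommonOut (D : Digraph V) (k : ℕ) (u v : V) : Prop :=
  k ≤ {x | D.Adj u x ∧ D.Adj v x}.ncard

theorem minOutDeg_le_outDeg (D : Digraph V) (v : V) : D.minOutDeg ≤ D.outDeg v :=
  ciInf_le (OrderBot.bddBelow _) v

theorem outDeg_add_outDeg_add_outDeg_le [Finite V] (D : Digraph V) (u v w : V) :
    D.outDeg u + D.outDeg v + D.outDeg w ≤ Nat.card V +
      {x | D.Adj u x ∧ D.Adj v x}.ncard + {x | D.Adj u x ∧ D.Adj w x}.ncard +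
      {x | D.Adj v x ∧ D.Adj w x}.ncard := by
  classical
  have h1 := Set.ncard_union_add_ncard_inter {x | D.Adj u x} {x | D.Adj v x}
  have h2 := Set.ncard_union_add_ncard_inter ({x | D.Adj u x} ∪ {x | D.Adj v x}) {x | D.Adj w x}
  have h3 : (({x | D.Adj u x} ∪ {x | D.Adj v x}) ∩ {x | D.Adj w x}).ncard ≤
      {x | D.Adj u x ∧ D.Adj w x}.ncard + {x | D.Adj v x ∧ D.Adj w x}.ncard := by
    rw [Set.union_inter_distrib_right]
    exact Set.ncard_union_le _ _
  have h4 := Set.ncard_le_card (({x | D.Adj u x} ∪ {x | D.Adj v x}) ∪ {x | D.Adj w x})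
  have h5 : {x | D.Adj u x} ∩ {x | D.Adj v x} = {x | D.Adj u x ∧ D.Adj v x} := rfl
  rw [h5] at h1
  unfold outDeg
  omega

theorem sharesOut_of_lt_minOutDeg [Finite V] {D : Digraph V} (hD : D.Loopless) {k : ℕ}
    (hk : 21 ≤ k) (h : Nat.card V + 3 * k ≤ 3 * D.minOutDeg) :
    SharesOut D (D.ManyCommonOut k) where
  loopless := hD
  refl u := by
    have h1 := D.minOutDeg_le_outDeg u
    simp only [ManyCommonOut, and_self]
    unfold outDeg at h1
    omega
  symm u v := by
    simp only [ManyCommonOut, and_comm, imp_self]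
  three u v w _ _ _ := by
    have h1 := D.minOutDeg_le_outDeg u
    have h2 := D.minOutDeg_le_outDeg v
    have h3 := D.minOutDeg_le_outDeg w
    have h4 := D.outDeg_add_outDeg_add_outDeg_le u v w
    unfold ManyCommonOut
    omega
  pick u v huv l hl := by
    classical
    unfold ManyCommonOut at huv
    have h1 : (l.toFinset : Set V).ncard < {x | D.Adj u x ∧ D.Adj v x}.ncard := by
      rw [Set.ncard_coe_finset]
      have := l.toFinset_card_le
      omega
    obtain ⟨x, hx, hxl⟩ := Set.exists_mem_notMem_of_ncard_lt_ncard h1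
    exact ⟨x, by simpa using hxl, hx⟩

theorem isBipartite_of_lt_minOutDeg {ε : ℝ} (hε : 0 < ε) : ∃ n₀ : ℕ,
    ∀ H ∈ ({pentagon1, pentagon2, pentagon3} : Set (Digraph (Fin 5))),
    ∀ (V : Type) [Finite V] (D : Digraph V), D.Loopless →
      n₀ ≤ Nat.card V →
      (1 / 3 + ε) * (Nat.card V : ℝ) < (D.minOutDeg : ℝ) →
      ¬ H.ContainedIn D →
      D.underlying.IsBipartite := by
  -- The surplus 3εn must reach 3 · 21: with 21 common out-neighbours, one survives the exclusion of
  -- any 20 vertices.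
  obtain ⟨n₀, hn₀⟩ := exists_nat_ge (21 / ε)
  refine ⟨n₀ + 1, fun H hH V _ D hD hn hdeg hfree => ?_⟩
  have : Nonempty V := (Nat.card_pos_iff.1 (by omega)).1
  have hcard : (n₀ : ℝ) ≤ (Nat.card V : ℝ) := by
    exact_mod_cast (by omega : n₀ ≤ Nat.card V)
  have h1 : 21 ≤ ε * Nat.card V := by
    rw [div_le_iff₀ hε] at hn₀
    nlinarith
  have h2 : ((Nat.card V + 3 * 21 : ℕ) : ℝ) ≤ ((3 * D.minOutDeg : ℕ) : ℝ) := by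
    push_cast
    linarith
  have h3 := sharesOut_of_lt_minOutDeg hD le_rfl (by exact_mod_cast h2)
  rcases hH with rfl | rfl | rfl
  · exact h3.isBipartite_of_not_pentagon1 hfree
  · exact h3.isBipartite_of_not_pentagon2 hfree
  · exact h3.isBipartite_of_not_pentagon3 hfree

theorem chromaticProfile_two_eq {H : Digraph (Fin 5)}
    (hH : H ∈ ({pentagon1, pentagon2, pentagon3} : Set (Digraph (Fin 5))))
    (hlow : ∀ m : ℕ, 2 ≤ m → ∃ (V : Type) (_ : Finite V) (D : Digraph V), D.Loopless ∧
      m ≤ D.minOutDeg ∧ m ≤ Nat.card V ∧ Nat.card V ≤ 3 * m + 1 ∧ ¬ H.ContainedIn D ∧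
      ¬ D.underlying.Colorable 2) :
    H.chromaticProfile 2 = 1 / 3 := by
  have lower : ∀ d ∈ H.profileSet 2, 1 / 3 ≤ d := by
    rintro d ⟨n₀, hd⟩
    by_contra! hlt
    -- For nonnegative `d` this forces m(1 - 3d) ≥ 1 > d, hence d(3m + 1) ≤ m.
    obtain ⟨m, hm⟩ := exists_nat_ge (1 / (1 - 3 * d))
    have hpos : 0 < 1 - 3 * d := by linarith
    obtain ⟨V, _, D, hD, hdeg, hcard, hcard', hfree, hcol⟩ := hlow (m + n₀ + 2) (by omega)
    refine hcol (SimpleGraph.chromaticNumber_le_iff_colorable.1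
      (hd V D hD (by omega) ?_ hfree))
    have h1 : ((m + n₀ + 2 : ℕ) : ℝ) ≤ D.minOutDeg := by exact_mod_cast hdeg
    have h2 : (Nat.card V : ℝ) ≤ 3 * ((m + n₀ + 2 : ℕ) : ℝ) + 1 := by exact_mod_cast hcard'
    have h3 : (m : ℝ) ≤ ((m + n₀ + 2 : ℕ) : ℝ) := by exact_mod_cast (by omega)
    rw [div_le_iff₀ hpos] at hm
    rcases le_total d 0 with h0 | h0
    · have : d * (Nat.card V : ℝ) ≤ 0 := mul_nonpos_of_nonpos_of_nonneg h0 (by positivity)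
      exact this.trans (by positivity)
    · nlinarith
  refine le_antisymm (le_of_forall_pos_le_add fun ε hε => ?_) ?_
  · refine csInf_le ⟨1 / 3, fun d hd => lower d hd⟩ ?_
    -- Halving ε turns the non-strict degree bound of the profile into the strict one required.
    obtain ⟨n₀, hn₀⟩ := isBipartite_of_lt_minOutDeg (half_pos hε)
    refine ⟨n₀ + 1, fun V _ D hD hn hdeg hfree => ?_⟩
    have hpos : (0 : ℝ) < Nat.card V := by exact_mod_cast (by omega : 0 < Nat.card V)
    exact SimpleGraph.chromaticNumber_le_iff_colorable.2
      (hn₀ H hH V D hD (by omega) (by nlinarith) hfree)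
  · refine le_csInf ?_ lower
    obtain ⟨n₀, hn₀⟩ := isBipartite_of_lt_minOutDeg one_pos
    refine ⟨2, n₀ + 1, fun V _ D hD hn hdeg hfree => ?_⟩
    have hpos : (0 : ℝ) < Nat.card V := by exact_mod_cast (by omega : 0 < Nat.card V)
    exact SimpleGraph.chromaticNumber_le_iff_colorable.2
      (hn₀ H hH V D hD (by omega) (by nlinarith) hfree)

/-! ### Extremal digraphs for the lower bound -/

theorem le_outDeg_of_injective [Finite V] {D : Digraph V} {m : ℕ} {v : V} (f : Fin m → V)
    (hf : Function.Injective f) (h : ∀ i, D.Adj v (f i)) : m ≤ D.outDeg v := by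
  have h1 : (Set.range f).ncard = m := by
    rw [← Nat.card_coe_set_eq, Nat.card_range_of_injective hf, Nat.card_fin]
  have h2 : Set.range f ⊆ {w | D.Adj v w} := by
    rintro _ ⟨i, rfl⟩
    exact h i
  unfold outDeg
  exact h1 ▸ Set.ncard_le_ncard h2

theorem le_minOutDeg [Nonempty V] {D : Digraph V} {m : ℕ} (h : ∀ v, m ≤ D.outDeg v) :
    m ≤ D.minOutDeg :=
  le_ciInf h

theorem adj_underlying {D : Digraph V} (hD : D.Loopless) {u v : V} (h : D.Adj u v) :
    D.underlying.Adj u v := by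
  refine (SimpleGraph.fromRel_adj _ _ _).2 ⟨?_, Or.inl h⟩
  rintro rfl
  exact hD _ h

/-- The blow-up of a directed triangle with parts of size `m`. -/
def triangleBlowup (m : ℕ) : Digraph (ZMod 3 × Fin m) where
  Adj u v := v.1 = u.1 + 1

theorem triangleBlowup_loopless (m : ℕ) : (triangleBlowup m).Loopless := by
  rintro ⟨i, x⟩ h
  simp [triangleBlowup] at h

theorem le_minOutDeg_triangleBlowup {m : ℕ} (hm : 0 < m) :
    m ≤ (triangleBlowup m).minOutDeg := by
  have : Nonempty (ZMod 3 × Fin m) := ⟨(0, ⟨0, hm⟩)⟩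
  exact le_minOutDeg fun v => le_outDeg_of_injective (fun i => (v.1 + 1, i))
    (fun i j hij => (Prod.ext_iff.1 hij).2) fun i => rfl

theorem not_colorable_triangleBlowup {m : ℕ} (hm : 0 < m) :
    ¬ (triangleBlowup m).underlying.Colorable 2 := by
  rintro ⟨C⟩
  have h : ∀ i : ZMod 3, C (i, ⟨0, hm⟩) ≠ C (i + 1, ⟨0, hm⟩) := fun i =>
    C.valid (adj_underlying (triangleBlowup_loopless m) rfl)
  have h0 := h 0
  have h1 := h 1
  have h2 := h 2
  rw [show (0 : ZMod 3) + 1 = 1 from rfl] at h0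
  rw [show (1 : ZMod 3) + 1 = 2 from rfl] at h1
  rw [show (2 : ZMod 3) + 1 = 0 from rfl] at h2
  revert h0 h1 h2
  generalize C (0, _) = a
  generalize C (1, _) = b
  generalize C (2, _) = c
  revert a b c
  decide

/-- Two directed paths with the same ends have equal length mod 3 here, but 3 ≢ 2. -/
theorem not_pentagon2_triangleBlowup (m : ℕ) : ¬ pentagon2.ContainedIn (triangleBlowup m) := by
  rintro ⟨f, -, hf⟩
  have h1 : (f 4).1 = (f 0).1 + 1 := hf 0 4 (by simp [pentagon2, ofArcs5])
  have h2 : (f 3).1 = (f 4).1 + 1 := hf 4 3 (by simp [pentagon2, ofArcs5])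
  have h3 : (f 2).1 = (f 3).1 + 1 := hf 3 2 (by simp [pentagon2, ofArcs5])
  have h4 : (f 2).1 = (f 1).1 + 1 := hf 1 2 (by simp [pentagon2, ofArcs5])
  have h5 : (f 1).1 = (f 0).1 + 1 := hf 0 1 (by simp [pentagon2, ofArcs5])
  rw [h3, h2, h1, h5] at h4
  generalize (f 0).1 = a at h4
  revert a
  decide

theorem not_pentagon3_triangleBlowup (m : ℕ) : ¬ pentagon3.ContainedIn (triangleBlowup m) := by
  rintro ⟨f, -, hf⟩
  have h1 : (f 4).1 = (f 0).1 + 1 := hf 0 4 (by simp [pentagon3, ofArcs5])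
  have h2 : (f 3).1 = (f 4).1 + 1 := hf 4 3 (by simp [pentagon3, ofArcs5])
  have h3 : (f 3).1 = (f 2).1 + 1 := hf 2 3 (by simp [pentagon3, ofArcs5])
  have h4 : (f 1).1 = (f 2).1 + 1 := hf 2 1 (by simp [pentagon3, ofArcs5])
  have h5 : (f 1).1 = (f 0).1 + 1 := hf 0 1 (by simp [pentagon3, ofArcs5])
  rw [h5] at h4
  rw [h2, h1] at h3
  generalize (f 0).1 = a at h3 h4
  generalize (f 2).1 = b at h3 h4
  revert a b
  decide

/-- The part of `sourceDigraph` formed by the out-neighbours of a vertex. -/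
def sourceTarget {m : ℕ} : Option (Fin 3 × Fin m) → Fin 3
  | none => 2
  | some p => if p.1 = 0 then 1 else if p.1 = 1 then 0 else if p.2.1 = 0 then 0 else 1

/-- A source `none` dominates the part `2`; one vertex of the part `2` dominates the part `0`, the
other ones dominate the part `1`, and the parts `0` and `1` dominate each other. -/
def sourceDigraph (m : ℕ) : Digraph (Option (Fin 3 × Fin m)) where
  Adj u v := ∃ x, v = some (sourceTarget u, x)

theorem sourceTarget_ne_two {m : ℕ} {u : Option (Fin 3 × Fin m)} (hu : u ≠ none) :
    sourceTarget u ≠ 2 := by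
  rcases u with _ | p
  · exact absurd rfl hu
  · simp only [sourceTarget]
    split_ifs <;> decide

/-- Away from the source, `sourceTarget` is a proper 2-colouring. -/
theorem sourceTarget_of_adj {m : ℕ} {u v : Option (Fin 3 × Fin m)} (hu : u ≠ none)
    (h : (sourceDigraph m).Adj u v) : sourceTarget v = 0 ↔ sourceTarget u ≠ 0 := by
  obtain ⟨x, rfl⟩ := h
  have h2 := sourceTarget_ne_two hu
  generalize sourceTarget u = i at *
  fin_cases i <;> simp_all [sourceTarget]

theorem ne_none_of_sourceDigraph_adj {m : ℕ} {u v : Option (Fin 3 × Fin m)}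
    (h : (sourceDigraph m).Adj u v) : v ≠ none := by
  obtain ⟨x, rfl⟩ := h
  simp

theorem eq_none_of_adj_of_adj_none {m : ℕ} {u v : Option (Fin 3 × Fin m)}
    (hv : (sourceDigraph m).Adj none v) (h : (sourceDigraph m).Adj u v) : u = none := by
  obtain ⟨x, rfl⟩ := hv
  obtain ⟨y, hy⟩ := h
  by_contra hu
  exact sourceTarget_ne_two hu (congrArg Prod.fst (Option.some_injective _ hy)).symm

theorem sourceDigraph_loopless (m : ℕ) : (sourceDigraph m).Loopless := by
  intro u h
  have := sourceTarget_of_adj (ne_none_of_sourceDigraph_adj h) h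
  tauto

theorem le_minOutDeg_sourceDigraph (m : ℕ) : m ≤ (sourceDigraph m).minOutDeg :=
  le_minOutDeg fun v => le_outDeg_of_injective (fun i => some (sourceTarget v, i))
    (fun a b hab => by simpa using hab) fun i => ⟨i, rfl⟩

theorem not_colorable_sourceDigraph {m : ℕ} (hm : 2 ≤ m) :
    ¬ (sourceDigraph m).underlying.Colorable 2 := by
  rintro ⟨C⟩
  have key : ∀ u v, (sourceDigraph m).Adj u v → C u ≠ C v := fun u v h =>
    C.valid (adj_underlying (sourceDigraph_loopless m) h)
  have h1 := key none (some (2, ⟨0, by omega⟩)) ⟨_, rfl⟩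
  have h2 := key none (some (2, ⟨1, by omega⟩)) ⟨_, rfl⟩
  have h3 := key (some (2, ⟨0, by omega⟩)) (some (0, ⟨0, by omega⟩)) ⟨_, rfl⟩
  have h4 := key (some (2, ⟨1, by omega⟩)) (some (1, ⟨0, by omega⟩)) ⟨_, rfl⟩
  -- These five arcs form an undirected 5-cycle; `2 ≤ m` supplies both kinds of vertices of part
  -- `2`.
  have h5 := key (some (0, ⟨0, by omega⟩)) (some (1, ⟨0, by omega⟩)) ⟨_, rfl⟩
  revert h1 h2 h3 h4 h5
  generalize C none = a
  generalize C (some (2, ⟨0, _⟩)) = b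
  generalize C (some (2, ⟨1, _⟩)) = c
  generalize C (some (0, _)) = d
  generalize C (some (1, _)) = e
  omega

theorem not_pentagon1_sourceDigraph (m : ℕ) : ¬ pentagon1.ContainedIn (sourceDigraph m) := by
  rintro ⟨f, -, hf⟩
  have h1 := hf 0 4 (by simp [pentagon1, ofArcs5])
  have h2 := hf 4 3 (by simp [pentagon1, ofArcs5])
  have h3 := hf 3 2 (by simp [pentagon1, ofArcs5])
  have h4 := hf 2 1 (by simp [pentagon1, ofArcs5])
  have h5 := hf 0 1 (by simp [pentagon1, ofArcs5])
  have ne : ∀ {u v}, (sourceDigraph m).Adj u v → v ≠ none := ne_none_of_sourceDigraph_adj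
  -- Out-neighbours of the source have no other in-neighbour, whereas vertex 1 of C'_5 has two. So
  -- the pentagon misses the source and is an odd cycle in a bipartite graph.
  have h0 : f 0 ≠ none := fun h0 => ne h3 (eq_none_of_adj_of_adj_none (h0 ▸ h5) h4)
  have s1 := sourceTarget_of_adj h0 h1
  have s2 := sourceTarget_of_adj (ne h1) h2
  have s3 := sourceTarget_of_adj (ne h2) h3
  have s4 := sourceTarget_of_adj (ne h3) h4
  have s5 := sourceTarget_of_adj h0 h5
  tauto

end Digraph

theorem mainTheorem4 :
    (pentagon1.chromaticProfile 2 = 1 / 3 ∧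
      pentagon2.chromaticProfile 2 = 1 / 3 ∧
      pentagon3.chromaticProfile 2 = 1 / 3) ∧
    ∀ ε : ℝ, 0 < ε → ∃ n₀ : ℕ,
      ∀ H ∈ ({pentagon1, pentagon2, pentagon3} : Set (Digraph (Fin 5))),
      ∀ (V : Type) [Finite V] (D : Digraph V), D.Loopless →
        n₀ ≤ Nat.card V →
        (1 / 3 + ε) * (Nat.card V : ℝ) < (D.minOutDeg : ℝ) →
        ¬ H.ContainedIn D →
        D.underlying.IsBipartite := by
  refine ⟨⟨?_, ?_, ?_⟩, fun ε hε => Digraph.isBipartite_of_lt_minOutDeg hε⟩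
  · refine Digraph.chromaticProfile_two_eq (by simp) fun m hm => ?_
    have hcard : Nat.card (Option (Fin 3 × Fin m)) = 3 * m + 1 := by simp
    exact ⟨_, inferInstance, Digraph.sourceDigraph m, Digraph.sourceDigraph_loopless m,
      Digraph.le_minOutDeg_sourceDigraph m, by omega, by omega,
      Digraph.not_pentagon1_sourceDigraph m, Digraph.not_colorable_sourceDigraph hm⟩
  · refine Digraph.chromaticProfile_two_eq (by simp) fun m hm => ?_
    have hcard : Nat.card (ZMod 3 × Fin m) = 3 * m := by simp
    exact ⟨_, inferInstance, Digraph.triangleBlowup m, Digraph.triangleBlowup_loopless m,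
      Digraph.le_minOutDeg_triangleBlowup (by omega), by omega, by omega,
      Digraph.not_pentagon2_triangleBlowup m, Digraph.not_colorable_triangleBlowup (by omega)⟩
  · refine Digraph.chromaticProfile_two_eq (by simp) fun m hm => ?_
    have hcard : Nat.card (ZMod 3 × Fin m) = 3 * m := by simp
    exact ⟨_, inferInstance, Digraph.triangleBlowup m, Digraph.triangleBlowup_loopless m,
      Digraph.le_minOutDeg_triangleBlowup (by omega), by omega, by omega,
      Digraph.not_pentagon3_triangleBlowup m, Digraph.not_colorable_triangleBlowup (by omega)⟩
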